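/- A monoidal category $(\mathbb G,\otimes,I,\mathbf a,\mathbf l,\mathbf r)$ is a *Gr-category* if every morphism of $\mathbb G$ is an isomorphism and every object $X$ is invertible, i.e. there is an object $Y$ with $X\otimes Y\cong I\cong Y\otimes X$. It is *strict* if the associativity constraint $\mathbf a$ and the unit constraints $\mathbf l,\mathbf r$ are all identities. Two Gr-categories $\mathbb G,\mathbb G'$ are *Gr-equivalent* if there are monoidal functors $F:\mathbb G\to\mathbb G'$ and $G:\mathbb G'\to\mathbb G$ (whose structure morphisms $FX\otimes FY\to F(X\otimes Y)$ and $I'\to FI$, and likewise for $G$, are isomorphisms) together with monoidal natural isomorphisms $GF\cong \mathrm{id}_{\mathbb G}$ and $FG\cong \mathrm{id}_{\mathbb G'}$. **Theorem.** Every Gr-category is Gr-equivalent to a strict Gr-category. -/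

import Mathlib

open CategoryTheory MonoidalCategory

universe v u v' u'

/-- A Gr-category: a monoidal category in which every morphism is an isomorphism and every object
is invertible, up to isomorphism, for the tensor product. -/
class IsGrCategory (C : Type u) [Category.{v} C] [MonoidalCategory C] : Prop
    extends IsGroupoid C where
  exists_inverse : ∀ X : C, ∃ Y : C, Nonempty (X ⊗ Y ≅ 𝟙_ C) ∧ Nonempty (Y ⊗ X ≅ 𝟙_ C)

/-- A monoidal category is strict if its associativity and unit constraints are identities: their
sources and targets are equal objects, and the constraints are the identities along these
equalities. -/
class IsStrictMonoidal (C : Type u) [Category.{v} C] [MonoidalCategory C] : Prop where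
  tensor_assoc : ∀ X Y Z : C, (X ⊗ Y) ⊗ Z = X ⊗ (Y ⊗ Z)
  unit_tensor : ∀ X : C, 𝟙_ C ⊗ X = X
  tensor_unit : ∀ X : C, X ⊗ 𝟙_ C = X
  associator_eq : ∀ X Y Z : C, α_ X Y Z = eqToIso (tensor_assoc X Y Z)
  leftUnitor_eq : ∀ X : C, λ_ X = eqToIso (unit_tensor X)
  rightUnitor_eq : ∀ X : C, ρ_ X = eqToIso (tensor_unit X)

/-- Monoidal equivalence (for Gr-categories: Gr-equivalence): there are monoidal functors `F` and
`G` in opposite directions, whose structure morphisms are isomorphisms, and monoidal natural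
isomorphisms from both composites to the identity functors. -/
def MonoidallyEquivalent (C : Type u) [Category.{v} C] [MonoidalCategory C]
    (D : Type u') [Category.{v'} D] [MonoidalCategory D] : Prop :=
  ∃ (F : C ⥤ D) (_ : F.Monoidal) (G : D ⥤ C) (_ : G.Monoidal)
    (α : F ⋙ G ≅ 𝟭 C) (β : G ⋙ F ≅ 𝟭 D),
    NatTrans.IsMonoidal α.hom ∧ NatTrans.IsMonoidal β.hom

/-! Words in the objects of `C` form a strictly associative and unital monoid under concatenation.
Taking as morphisms those of `C` between the bracketed products makes evaluation fully faithful, and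
one-letter words make it essentially surjective. The monoidal axioms pull back along evaluation once
identity constraints on words are shown to evaluate to those of `C`: `listTensorAppend_assoc`,
`listTensorAppend_nil`. -/

section Strictification

variable {C : Type u} [Category.{v} C] [MonoidalCategory C]

/-- The right-bracketed tensor product of a list of objects. -/
def listTensor : List C → C
  | [] => 𝟙_ C
  | X :: l => X ⊗ listTensor l

/-- The tensor product of two lists is isomorphic to the tensor product of their concatenation. -/
def listTensorAppend : ∀ l m : List C, listTensor l ⊗ listTensor m ≅ listTensor (l ++ m)
  | [], m => λ_ (listTensor m)
  | X :: l, m => α_ X (listTensor l) (listTensor m) ≪≫ whiskerLeftIso X (listTensorAppend l m)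

/-- Needed for `associator_eq`. The inductive step is the pentagon with naturality of the
associator. -/
lemma listTensorAppend_assoc (l m n : List C) :
    (listTensorAppend l m).hom ▷ listTensor n ≫ (listTensorAppend (l ++ m) n).hom ≫
        eqToHom (congrArg listTensor (List.append_assoc l m n)) =
      (α_ (listTensor l) (listTensor m) (listTensor n)).hom ≫
        listTensor l ◁ (listTensorAppend m n).hom ≫ (listTensorAppend l (m ++ n)).hom := by
  induction l with
  | nil => simp [listTensor, listTensorAppend]
  | cons X l ih =>
    change ((α_ X (listTensor l) (listTensor m)).hom ≫ X ◁ (listTensorAppend l m).hom) ▷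
          listTensor n ≫ ((α_ X (listTensor (l ++ m)) (listTensor n)).hom ≫
            X ◁ (listTensorAppend (l ++ m) n).hom) ≫
          eqToHom (congrArg (X ⊗ ·) (congrArg listTensor (List.append_assoc l m n))) =
      (α_ (X ⊗ listTensor l) (listTensor m) (listTensor n)).hom ≫
        (X ⊗ listTensor l) ◁ (listTensorAppend m n).hom ≫
          (α_ X (listTensor l) (listTensor (m ++ n))).hom ≫
            X ◁ (listTensorAppend l (m ++ n)).hom
    -- Exposes the transport as whiskered by `X`, so that the whiskered induction hypothesis
    -- applies.
    rw [← whiskerLeft_eqToHom X (congrArg listTensor (List.append_assoc l m n))]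
    have ih' := congrArg (X ◁ ·) ih
    simp only [MonoidalCategory.whiskerLeft_comp] at ih'
    simp [ih', -whiskerLeft_eqToHom]

/-- Needed for `rightUnitor_eq`; the left unit holds by definition, as words are bracketed to the
right. -/
lemma listTensorAppend_nil (l : List C) :
    (listTensorAppend l []).hom ≫ eqToHom (congrArg listTensor (List.append_nil l)) =
      (ρ_ (listTensor l)).hom := by
  induction l with
  | nil => simp [listTensor, listTensorAppend, unitors_equal]
  | cons X l ih =>
    change ((α_ X (listTensor l) (listTensor [])).hom ≫ X ◁ (listTensorAppend l []).hom) ≫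
          eqToHom (congrArg (X ⊗ ·) (congrArg listTensor (List.append_nil l))) =
      (ρ_ (X ⊗ listTensor l)).hom
    rw [← whiskerLeft_eqToHom X (congrArg listTensor (List.append_nil l)), Category.assoc,
      ← MonoidalCategory.whiskerLeft_comp, ih]
    exact (rightUnitor_tensor_hom X (listTensor l)).symm

variable (C) in
/-- The strictification of a monoidal category: its objects are lists of objects, and its
morphisms are the morphisms between their tensor products. -/
abbrev Strictification : Type u := InducedCategory C (listTensor (C := C))

namespace Strictification

variable (C) in
/-- The functor sending a list of objects to its tensor product. -/
abbrev tensorFunctor : Strictification C ⥤ C := inducedFunctor listTensor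

instance : MonoidalCategoryStruct (Strictification C) where
  tensorObj l m := List.append l m
  tensorUnit := ([] : List C)
  whiskerLeft l _ _ f := InducedCategory.homMk
    ((listTensorAppend l _).inv ≫ listTensor l ◁ f.hom ≫ (listTensorAppend l _).hom)
  whiskerRight f m := InducedCategory.homMk
    ((listTensorAppend _ m).inv ≫ f.hom ▷ listTensor m ≫ (listTensorAppend _ m).hom)
  tensorHom f g := InducedCategory.homMk
    ((listTensorAppend _ _).inv ≫ (f.hom ⊗ₘ g.hom) ≫ (listTensorAppend _ _).hom)
  associator l m n := eqToIso (List.append_assoc l m n)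
  leftUnitor l := eqToIso (List.nil_append l)
  rightUnitor l := eqToIso (List.append_nil l)

/-- The monoidal structure on lists is induced from the one on `C`. -/
def inducingFunctorData : Monoidal.InducingFunctorData (tensorFunctor C) where
  μIso l m := listTensorAppend l m
  εIso := Iso.refl _
  whiskerLeft_eq _ _ _ _ := rfl
  whiskerRight_eq _ _ := rfl
  tensorHom_eq _ _ := rfl
  associator_eq l m n := by
    refine (eqToHom_map (tensorFunctor C) (List.append_assoc l m n)).trans ?_
    simp only [Iso.trans_hom, Iso.symm_hom, tensorIso_hom, Iso.refl_hom, tensorHom_id,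
      id_tensorHom, Category.assoc]
    refine (Iso.eq_inv_comp _).2 ?_
    refine ((whiskerRightIso (listTensorAppend l m) (listTensor n)).eq_inv_comp).2 ?_
    exact listTensorAppend_assoc l m n
  leftUnitor_eq l := by
    simp only [Iso.trans_hom, Iso.symm_hom, tensorIso_hom, Iso.refl_hom, tensorHom_id,
      Category.assoc]
    refine (eqToHom_map (tensorFunctor C) (List.nil_append l)).trans ?_
    refine (Iso.eq_inv_comp _).2 ?_
    change (λ_ (listTensor l)).hom ≫ 𝟙 _ = 𝟙 (𝟙_ C) ▷ listTensor l ≫ (λ_ (listTensor l)).hom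
    simp
  rightUnitor_eq l := by
    simp only [Iso.trans_hom, Iso.symm_hom, tensorIso_hom, Iso.refl_hom, id_tensorHom,
      Category.assoc]
    refine (eqToHom_map (tensorFunctor C) (List.append_nil l)).trans ?_
    refine (Iso.eq_inv_comp _).2 ((listTensorAppend_nil l).trans ?_)
    change (ρ_ (listTensor l)).hom = listTensor l ◁ 𝟙 (𝟙_ C) ≫ (ρ_ (listTensor l)).hom
    simp

instance : MonoidalCategory (Strictification C) :=
  Monoidal.induced (tensorFunctor C) inducingFunctorData

instance : (tensorFunctor C).Monoidal :=
  Monoidal.fromInducedMonoidal (tensorFunctor C) inducingFunctorData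

instance : IsStrictMonoidal (Strictification C) where
  tensor_assoc := List.append_assoc
  unit_tensor := List.nil_append
  tensor_unit := List.append_nil
  associator_eq _ _ _ := rfl
  leftUnitor_eq _ := rfl
  rightUnitor_eq _ := rfl

instance : (tensorFunctor C).EssSurj where
  mem_essImage X := ⟨([X] : List C), ⟨ρ_ X⟩⟩

instance : (tensorFunctor C).IsEquivalence where

instance [IsGrCategory C] : IsGrCategory (Strictification C) where
  all_isIso f := isIso_of_fully_faithful (tensorFunctor C) f
  exists_inverse l := by
    obtain ⟨Y, ⟨e⟩, ⟨e'⟩⟩ := IsGrCategory.exists_inverse (listTensor l)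
    -- The word `[Y]` evaluates to `Y ⊗ 𝟙_ C`, hence the `ρ_ Y` below.
    let s : Strictification C := ([Y] : List C)
    exact ⟨s,
      ⟨InducedCategory.isoMk ((listTensorAppend l [Y]).symm ≪≫
        whiskerLeftIso (listTensor l) (ρ_ Y) ≪≫ e)⟩,
      ⟨InducedCategory.isoMk ((listTensorAppend [Y] l).symm ≪≫
        whiskerRightIso (ρ_ Y) (listTensor l) ≪≫ e')⟩⟩

end Strictification

end Strictification

/-- An equivalence of categories with a monoidal functor gives a monoidal equivalence. -/
theorem MonoidallyEquivalent.of_equivalence {C : Type u} [Category.{v} C] [MonoidalCategory C]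
    {D : Type u'} [Category.{v'} D] [MonoidalCategory D] (e : D ≌ C) [e.functor.Monoidal] :
    MonoidallyEquivalent C D := by
  -- The inverse gets its monoidal structure through the adjunction, which makes unit and counit
  -- monoidal.
  let := e.inverseMonoidal
  have : e.IsMonoidal := ⟨rfl, fun _ _ => rfl⟩
  have : NatTrans.IsMonoidal e.unitIso.hom := inferInstanceAs (NatTrans.IsMonoidal e.unit)
  exact ⟨e.inverse, inferInstance, e.functor, inferInstance, e.counitIso, e.unitIso.symm,
    inferInstanceAs (NatTrans.IsMonoidal e.counit),
    inferInstanceAs (NatTrans.IsMonoidal e.unitIso.inv)⟩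

/-- Every Gr-category is Gr-equivalent to a strict Gr-category (in the same universes). -/
theorem theorem5p3 (C : Type u) [Category.{v} C] [MonoidalCategory C] [IsGrCategory C] :
    ∃ (D : Type u) (_ : Category.{v} D) (_ : MonoidalCategory D),
      IsGrCategory D ∧ IsStrictMonoidal D ∧ MonoidallyEquivalent C D :=
  ⟨Strictification C, inferInstance, inferInstance, inferInstance, inferInstance,
    @MonoidallyEquivalent.of_equivalence _ _ _ _ _ _
      (Strictification.tensorFunctor C).asEquivalence
      (inferInstance : (Strictification.tensorFunctor C).Monoidal)⟩
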